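/- **Setting.** All spaces are second countable locally compact Hausdorff spaces with their Borel $\sigma$-algebras, and $\mathcal C(X)$ is the space of compact subsets of $X$ with the Hausdorff (equivalently Michael, or Vietoris) topology. A *hypergroup* $(D,*)$ is such a space $D$ with a weakly continuous, associative, bilinear convolution $*$ on the bounded complex regular Borel measures of $D$, given by its values $\delta_x*\delta_y$ on point masses, such that: (i) each $\delta_x*\delta_y$ is a probability measure with compact support, and both $\delta_x*\delta_y$ (weakly) and $\operatorname{supp}(\delta_x*\delta_y)\in\mathcal C(D)$ depend continuously on $(x,y)$; (ii) there is $e\in D$ with $\delta_x*\delta_e=\delta_e*\delta_x=\delta_x$ for all $x$; (iii) there is a continuous involution $x\mapsto\bar x$ with $e\in\operatorname{supp}(\delta_x*\delta_y)\iff y=\bar x$, and the image of $\delta_x*\delta_y$ under the involution is $\delta_{\bar y}*\delta_{\bar x}$. A *left Haar measure* is a nonzero positive Radon measure $\omega_D$ on $D$ with $\int_D\int_D f\,d(\delta_x*\delta_y)\,d\omega_D(y)=\int_D f\,d\omega_D$ for all $f\in C_c(D)$, $x\in D$. A *continuous association scheme* (CAS) $(X,D,K)$ consists of such spaces $X,D$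 and a Markov kernel $K$ from $X\times D$ to $X$ whose transition operator maps $C_b(X)$ into $C_b(X\times D)$. Writing $K_h(x,\cdot)=K((x,h),\cdot)$ and $T_hf(x)=\int_X f(y)\,K_h(x,dy)$, it is required that: 1. $\operatorname{supp}K_h(x,\cdot)$ is compact and depends continuously on $(x,h)$ as an element of $\mathcal C(X)$; 2. for each $x\in X$ the sets $\operatorname{supp}K_h(x,\cdot)$, $h\in D$, form a partition of $X$, and the map $\pi:X\times X\to D$ with $y\in\operatorname{supp}K_{\pi(x,y)}(x,\cdot)$ is continuous; 3. $D$ carries a hypergroup structure with $\int_X K_{h_2}(y,A)\,K_{h_1}(x,dy)=\int_D K_h(x,A)\,d(\delta_{h_1}*\delta_{h_2})(h)$ for all $h_1,h_2\in D$, $x\in X$ and Borel sets $A\subset X$, and $K_e(x,\cdot)=\delta_x$ for all $x\in X$; 4. there is a positive Radon measure $\omega_X$ on $X$ with $\operatorname{supp}\omega_X=X$ and $\int_X T_{\bar h}f\cdot g\,d\omega_X=\int_X f\cdot T_hg\,d\omega_X$ for all $h\in D$ and $f,g\in C_c(X)$. Any measure $\omega_X$ as in 4 is called an *invariant measure* of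 the CAS. The CAS is *compact* if $X$ and $D$ are compact. It has *property (T2)* if a left Haar measure $\omega_D$ and an invariant measure $\omega_X$ can be chosen such that for all $f\in C_c(D)$, $g\in C_c(X)$ and $x\in X$ $$\int_D\int_X g(y)\,K_h(x,dy)\,f(h)\,d\omega_D(h)=\int_X f(\pi(x,y))\,g(y)\,d\omega_X(y).\tag{$*$}$$ **Proposition.** Let $(X,D,K)$ be a compact CAS. Then: (a) $(X,D,K)$ has property (T2). (b) For every left Haar measure $\omega_D$ and every invariant measure $\omega_X$ there is a constant $c>0$ such that, after replacing $\omega_D$ by $c\,\omega_D$, identity $(*)$ holds and $\omega_X(A)=\int_D K_h(x,A)\,d\omega_D(h)$ for all $x\in X$ and all Borel sets $A\subset X$. (c) The invariant measure is unique up to a positive constant: any two invariant measures are positive multiples of each other. -/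

import Mathlib

open MeasureTheory ProbabilityTheory TopologicalSpace
open scoped NNReal ENNReal CompactlySupported BoundedContinuousFunction

/-- A hypergroup structure on a second countable, locally compact Hausdorff space `D`.

A bilinear convolution on the bounded complex regular Borel measures that is weakly continuous is
determined by the products of point masses through `μ * ν = ∫∫ δ_x * δ_y dμ(x) dν(y)`. It is
recorded here by these products: `conv x y` is `δ_x * δ_y`. On a second countable, locally compact
Hausdorff space every finite Borel measure is regular, and the topology on `Compacts D` is the
Michael (Vietoris) topology. -/
structure HypergroupStructure (D : Type*) [TopologicalSpace D] [LocallyCompactSpace D] [T2Space D]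
    [SecondCountableTopology D] [MeasurableSpace D] [BorelSpace D] where
  /-- The probability measure `δ_x * δ_y`. -/
  conv : D → D → ProbabilityMeasure D
  /-- Weak continuity of the convolution. -/
  continuous_conv : Continuous fun p : D × D => conv p.1 p.2
  /-- Associativity: `(δ_x * δ_y) * δ_z = δ_x * (δ_y * δ_z)`. -/
  conv_assoc : ∀ (x y z : D) (A : Set D), MeasurableSet A →
    ∫⁻ w, (conv w z : Measure D) A ∂(conv x y : Measure D) =
      ∫⁻ w, (conv x w : Measure D) A ∂(conv y z : Measure D)
  isCompact_support : ∀ x y : D, IsCompact (conv x y : Measure D).support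
  continuous_support : Continuous fun p : D × D =>
    (⟨(conv p.1 p.2 : Measure D).support, isCompact_support p.1 p.2⟩ : Compacts D)
  /-- The neutral element. -/
  e : D
  conv_e : ∀ x : D, (conv x e : Measure D) = Measure.dirac x
  e_conv : ∀ x : D, (conv e x : Measure D) = Measure.dirac x
  /-- The involution `x ↦ x̄`. -/
  bar : D → D
  continuous_bar : Continuous bar
  bar_bar : ∀ x : D, bar (bar x) = x
  e_mem_support_iff : ∀ x y : D, e ∈ (conv x y : Measure D).support ↔ y = bar x
  map_bar_conv : ∀ x y : D,
    (conv x y : Measure D).map bar = (conv (bar y) (bar x) : Measure D)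

/-- A left Haar measure: a nonzero positive Radon measure `ω` with
`∫ f(x * y) dω(y) = ∫ f dω` for all `f ∈ C_c(D)` and `x ∈ D`,
where `f(x * y) = ∫ f d(δ_x * δ_y)`. -/
structure HypergroupStructure.IsLeftHaar {D : Type*} [TopologicalSpace D] [LocallyCompactSpace D]
    [T2Space D] [SecondCountableTopology D] [MeasurableSpace D] [BorelSpace D]
    (H : HypergroupStructure D) (ω : Measure D) : Prop where
  regular : ω.Regular
  ne_zero : ω ≠ 0
  invariant : ∀ (f : C_c(D, ℂ)) (x : D),
    ∫ y, (∫ z, f z ∂(H.conv x y : Measure D)) ∂ω = ∫ y, f y ∂ω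

/-- The transition operator `T_h f(x) = ∫ f(y) K(x, h; dy)` of a kernel from `X × D` to `X`. -/
noncomputable def transitionOp {X D : Type*} [MeasurableSpace X] [MeasurableSpace D]
    (K : Kernel (X × D) X) (h : D) (f : X → ℂ) (x : X) : ℂ :=
  ∫ y, f y ∂(K (x, h))

/-- `ω` is a positive Radon measure on `X` with full support such that
`∫ T_{h̄} f · g dω = ∫ f · T_h g dω` for all `h ∈ D` and `f, g ∈ C_c(X)`. -/
structure IsAdjointMeasure {X D : Type*} [TopologicalSpace X] [MeasurableSpace X]
    [MeasurableSpace D] (K : Kernel (X × D) X) (bar : D → D) (ω : Measure X) : Prop where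
  regular : ω.Regular
  support_eq : ω.support = Set.univ
  adjoint : ∀ (h : D) (f g : C_c(X, ℂ)),
    ∫ x, transitionOp K (bar h) f x * g x ∂ω = ∫ x, f x * transitionOp K h g x ∂ω

/-- A continuous association scheme `(X, D, K)`. The topology on `Compacts X` is the Vietoris
topology, that is, the topology of any Hausdorff metric on the nonempty compact subsets. -/
structure ContinuousAssociationScheme (X D : Type*)
    [TopologicalSpace X] [LocallyCompactSpace X] [T2Space X] [SecondCountableTopology X]
    [MeasurableSpace X] [BorelSpace X]
    [TopologicalSpace D] [LocallyCompactSpace D] [T2Space D] [SecondCountableTopology D]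
    [MeasurableSpace D] [BorelSpace D] where
  /-- The Markov kernel from `X × D` to `X`. -/
  K : Kernel (X × D) X
  isMarkov : IsMarkovKernel K
  /-- The kernel is continuous: its transition operator maps `C_b(X)` into `C_b(X × D)`. -/
  continuous_kernel : ∀ f : X →ᵇ ℂ, Continuous fun p : X × D => ∫ y, f y ∂(K p)
  isCompact_support : ∀ p : X × D, IsCompact (K p).support
  continuous_support : Continuous fun p : X × D =>
    (⟨(K p).support, isCompact_support p⟩ : Compacts X)
  /-- The projection `π : X × X → D`. -/
  proj : X × X → D
  /-- For fixed `x` the supports of `K(x, h; ·)`, `h ∈ D`, partition `X`, and `π(x, y)` is the index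
  of the part that contains `y`. -/
  mem_support_iff : ∀ (x y : X) (h : D), y ∈ (K (x, h)).support ↔ proj (x, y) = h
  continuous_proj : Continuous proj
  /-- The hypergroup structure `(D, *)`. -/
  hypergroup : HypergroupStructure D
  /-- `K_{h₁} ∘ K_{h₂} = ∫ K_h d(δ_{h₁} * δ_{h₂})(h)`. -/
  comp_eq : ∀ (h₁ h₂ : D) (x : X) (A : Set X), MeasurableSet A →
    ∫⁻ y, K (y, h₂) A ∂(K (x, h₁)) =
      ∫⁻ h, K (x, h) A ∂(hypergroup.conv h₁ h₂ : Measure D)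
  kernel_e : ∀ x : X, K (x, hypergroup.e) = Measure.dirac x
  exists_adjointMeasure : ∃ ω : Measure X, IsAdjointMeasure K hypergroup.bar ω

namespace ContinuousAssociationScheme

/-- The identity `T_f = T^{f ∘ π}` for all `f ∈ C_c(D)`, as operators on `C_c(X)`, where
`T_f g(x) = ∫_D ∫_X g(y) K_h(x, dy) f(h) dω_D(h)` and
`T^F g(x) = ∫_X F(x, y) g(y) dω_X(y)`. -/
def TranslationIdentity {X D : Type*}
    [TopologicalSpace X] [LocallyCompactSpace X] [T2Space X] [SecondCountableTopology X]
    [MeasurableSpace X] [BorelSpace X]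
    [TopologicalSpace D] [LocallyCompactSpace D] [T2Space D] [SecondCountableTopology D]
    [MeasurableSpace D] [BorelSpace D]
    (S : ContinuousAssociationScheme X D) (ωD : Measure D) (ωX : Measure X) : Prop :=
  ∀ (f : C_c(D, ℂ)) (g : C_c(X, ℂ)) (x : X),
    ∫ h, transitionOp S.K h g x * f h ∂ωD = ∫ y, f (S.proj (x, y)) * g y ∂ωX

/-- The translation property (T2): `T_f = T^{f ∘ π}` for all `f ∈ C_c(D)`, for a suitable choice of
the invariant measure `ω_X` and of the left Haar measure `ω_D`. -/
def HasT2 {X D : Type*}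
    [TopologicalSpace X] [LocallyCompactSpace X] [T2Space X] [SecondCountableTopology X]
    [MeasurableSpace X] [BorelSpace X]
    [TopologicalSpace D] [LocallyCompactSpace D] [T2Space D] [SecondCountableTopology D]
    [MeasurableSpace D] [BorelSpace D]
    (S : ContinuousAssociationScheme X D) : Prop :=
  ∃ (ωD : Measure D) (ωX : Measure X), S.hypergroup.IsLeftHaar ωD ∧
    IsAdjointMeasure S.K S.hypergroup.bar ωX ∧ S.TranslationIdentity ωD ωX

end ContinuousAssociationScheme

open Filter Topology

/-! For continuous `f`, averaging `T_h f` over a left Haar measure gives a function `F` fixed by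
every `T_h`: composing kernels turns `T_{h₁}` into convolution by `δ_{h₁}`, which Haar measure
absorbs. The supports of `K_h(x₀, ·)` cover `X`, so the maximum principle at a maximum point `x₀`
makes `F` constant (`integral_integral_kernel_eq`). An invariant measure is stationary for every
`T_h`; integrating `F` against it identifies the constant and gives `ω_X = ∫ K_h(x, ·) d(c ω_D)(h)`
(`exists_eq_comp_smul`). Identity `(*)` follows because `π(x, ·) = h` on the support of `K_h(x, ·)`;
uniqueness follows because the right side depends on `ω_X` only through `c`. Existence of a left
Haar measure (`exists_integral_conv_eq`) combines Krylov–Bogoliubov for a random walk with steps of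
full support and a second maximum principle. -/

theorem MeasureTheory.Measure.integral_comp_kernel {A B : Type*} [MeasurableSpace A]
    [MeasurableSpace B]
    {E : Type*} [NormedAddCommGroup E] [NormedSpace ℝ E]
    {μ : Measure A} {κ : Kernel A B} {f : B → E} (hf : Integrable f (κ ∘ₘ μ)) :
    ∫ b, f b ∂(κ ∘ₘ μ) = ∫ a, ∫ b, f b ∂κ a ∂μ := by
  rw [Measure.comp_eq_comp_const_apply] at hf ⊢
  rw [Kernel.integral_comp hf, Kernel.const_apply]

/-! ### Maximum principle and stationary measures on compact spaces. -/

section General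

variable {A B : Type*} [TopologicalSpace A] [TopologicalSpace B]

theorem Continuous.integrable_of_compactSpace [CompactSpace A] [MeasurableSpace A]
    [OpensMeasurableSpace A] {E : Type*} [NormedAddCommGroup E] [SecondCountableTopologyEither A E]
    {μ : Measure A} [IsFiniteMeasure μ] {f : A → E} (hf : Continuous f) : Integrable f μ :=
  hf.integrable_of_hasCompactSupport (HasCompactSupport.of_compactSpace f)

theorem continuous_integral_of_compactSpace [CompactSpace B] [MeasurableSpace B]
    [OpensMeasurableSpace B] [FirstCountableTopology A] [LocallyCompactSpace A]
    {μ : Measure B} [IsFiniteMeasure μ] {f : A → B → ℝ} (hf : Continuous f.uncurry) :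
    Continuous fun a => ∫ b, f a b ∂μ := by
  simpa using continuous_parametric_integral_of_continuous (μ := μ) hf isCompact_univ

/-- A continuous function that nowhere exceeds its mean with respect to a probability measure is
constant on the support of the measure. -/
theorem eq_of_mem_support_of_integral_eq [CompactSpace A] [MeasurableSpace A]
    [OpensMeasurableSpace A] {μ : Measure A} [IsProbabilityMeasure μ] {F : A → ℝ}
    (hF : Continuous F) {M : ℝ} (hle : ∀ a, F a ≤ M) (hint : ∫ a, F a ∂μ = M) {a : A}
    (ha : a ∈ μ.support) : F a = M := by
  by_contra hne
  have hlt : F a < M := lt_of_le_of_ne (hle a) hne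
  have h0 : ∫ b, (M - F b) ∂μ = 0 := by
    rw [integral_sub (integrable_const M) hF.integrable_of_compactSpace, hint]; simp
  have hae : (fun b => M - F b) =ᵐ[μ] 0 :=
    (integral_eq_zero_iff_of_nonneg (fun b => sub_nonneg.2 (hle b))
      (continuous_const.sub hF).integrable_of_compactSpace).1 h0
  have hU : {b | F b < M} ∈ 𝓝 a := (isOpen_lt hF continuous_const).mem_nhds hlt
  refine ((Measure.mem_support_iff_forall a).1 ha _ hU).ne' ?_
  refine measure_mono_null (fun b hb => ?_) (ae_iff.1 hae)
  simp only [Set.mem_ofPred_eq, Pi.zero_apply] at hb ⊢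
  exact (sub_pos.2 hb).ne'

/-- Closed sets form a generating π-system, and the mass of a closed set is a limit of integrals of
continuous functions, each continuous in the parameter. -/
theorem measurable_of_continuous_integral [T2Space B] [CompactSpace B] [SecondCountableTopology B]
    [MeasurableSpace A] [OpensMeasurableSpace A] [MeasurableSpace B] [BorelSpace B]
    {κ : A → ProbabilityMeasure B} (hκ : Continuous κ) :
    Measurable fun a => (κ a : Measure B) := by
  refine Measurable.measure_of_isPiSystem_of_isProbabilityMeasure (S := {s | IsClosed s})
    (by rw [BorelSpace.measurable_eq (α := B), borel_eq_generateFrom_isClosed])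
    (fun s hs t ht _ => IsClosed.inter hs ht) fun s hs => ?_
  refine measurable_of_tendsto_metrizable (f := fun n a => ∫⁻ b, hs.apprSeq n b ∂(κ a : Measure B))
    (fun n => ?_) (tendsto_pi_nhds.2 fun a =>
      HasOuterApproxClosed.tendsto_lintegral_apprSeq hs (κ a : Measure B))
  exact ((ProbabilityMeasure.continuous_lintegral_boundedContinuousFunction _).comp hκ).measurable

/-- A probability measure of full support on a nonempty second countable space. -/
theorem exists_isProbabilityMeasure_isOpenPosMeasure (A : Type*) [TopologicalSpace A]
    [SecondCountableTopology A] [Nonempty A] [MeasurableSpace A] [OpensMeasurableSpace A] :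
    ∃ μ : Measure A, IsProbabilityMeasure μ ∧ μ.IsOpenPosMeasure := by
  let p : unitInterval := ⟨1 / 2, by norm_num, by norm_num⟩
  have hp0 : p ≠ 0 := fun h => by have := congrArg Subtype.val h; norm_num [p] at this
  have hp1 : p ≠ 1 := fun h => by have := congrArg Subtype.val h; norm_num [p] at this
  have hm : Measurable (denseSeq A) := measurable_from_nat
  refine ⟨(geometricMeasure p).map (denseSeq A), Measure.isProbabilityMeasure_map hm.aemeasurable,
    ⟨fun U hU hne => ?_⟩⟩
  obtain ⟨_, hxU, n, rfl⟩ := (denseRange_denseSeq A).inter_open_nonempty U hU hne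
  rw [Measure.map_apply hm hU.measurableSet]
  have h1 : 0 < (geometricMeasure p) {n} := by
    have := geometricMeasure_real_singleton_pos hp0 hp1 n
    rw [measureReal_def] at this
    exact (ENNReal.toReal_pos_iff.1 this).1
  exact (h1.trans_le (measure_mono (Set.singleton_subset_iff.2 hxU))).ne'

/-- **Krylov–Bogoliubov**: a Feller kernel on a nonempty compact space has an invariant
probability measure. -/
theorem exists_invariant_probabilityMeasure [T2Space A] [CompactSpace A]
    [SecondCountableTopology A] [Nonempty A] [MeasurableSpace A] [BorelSpace A]
    (κ : Kernel A A) [IsMarkovKernel κ]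
    (hκ : ∀ f : C(A, ℝ), Continuous fun a => ∫ b, f b ∂κ a) :
    ∃ m : ProbabilityMeasure A, ∀ f : C(A, ℝ),
      ∫ a, ∫ b, f b ∂κ a ∂(m : Measure A) = ∫ a, f a ∂(m : Measure A) := by
  let a₀ : A := Classical.arbitrary A
  let μ : ℕ → Measure A := fun n => (fun ν : Measure A => κ ∘ₘ ν)^[n] (Measure.dirac a₀)
  have hμs : ∀ n, μ (n + 1) = κ ∘ₘ μ n := fun n => Function.iterate_succ_apply' _ _ _
  have hμ : ∀ n, IsProbabilityMeasure (μ n) := by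
    intro n
    induction n with
    | zero => exact inferInstanceAs (IsProbabilityMeasure (Measure.dirac a₀))
    | succ n ih => rw [hμs]; infer_instance
  -- Cesàro means of the orbit of a point mass; `n + 1` terms keep the normalization finite.
  let ν : ℕ → Measure A := fun n => ((n + 1 : ℕ) : ℝ≥0∞)⁻¹ • ∑ k ∈ Finset.range (n + 1), μ k
  have hν : ∀ n, IsProbabilityMeasure (ν n) := fun n => ⟨by
    simp only [ν, Measure.smul_apply, Measure.finsetSum_apply, measure_univ, Finset.sum_const,
      Finset.card_range, smul_eq_mul, nsmul_eq_mul, mul_one]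
    exact ENNReal.inv_mul_cancel (by simp) (by simp)⟩
  have hνint : ∀ n (f : A → ℝ), Continuous f →
      ∫ a, f a ∂ν n = ((n + 1 : ℕ) : ℝ)⁻¹ * ∑ k ∈ Finset.range (n + 1), ∫ a, f a ∂μ k := by
    intro n f hf
    simp only [ν]
    rw [integral_smul_measure, integral_finsetSum_measure
      (fun k _ => hf.integrable_of_compactSpace), ENNReal.toReal_inv, ENNReal.toReal_natCast,
      smul_eq_mul]
  let P : ℕ → ProbabilityMeasure A := fun n => ⟨ν n, hν n⟩
  obtain ⟨m, -, hm⟩ := isCompact_univ.ultrafilter_le_nhds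
    ((hyperfilter ℕ).map P) (by simp)
  have hlim : Tendsto P (hyperfilter ℕ : Filter ℕ) (𝓝 m) := hm
  refine ⟨m, fun f => ?_⟩
  let Q : C(A, ℝ) := ⟨fun a => ∫ b, f b ∂κ a, hκ f⟩
  have hQ : Tendsto (fun n => ∫ a, Q a ∂ν n) (hyperfilter ℕ : Filter ℕ)
      (𝓝 (∫ a, Q a ∂(m : Measure A))) :=
    ((ProbabilityMeasure.continuous_integral_continuousMap Q).tendsto m).comp hlim
  have hf : Tendsto (fun n => ∫ a, f a ∂ν n) (hyperfilter ℕ : Filter ℕ)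
      (𝓝 (∫ a, f a ∂(m : Measure A))) :=
    ((ProbabilityMeasure.continuous_integral_continuousMap f).tendsto m).comp hlim
  -- The sum telescopes, so the defect of invariance is `O(1/n)`.
  have hdiff : ∀ n, ∫ a, Q a ∂ν n - ∫ a, f a ∂ν n =
      ((n + 1 : ℕ) : ℝ)⁻¹ * (∫ a, f a ∂μ (n + 1) - ∫ a, f a ∂μ 0) := by
    intro n
    have hstep : ∀ k, ∫ a, Q a ∂μ k = ∫ a, f a ∂μ (k + 1) := fun k => by
      rw [hμs, Measure.integral_comp_kernel f.continuous.integrable_of_compactSpace]; rfl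
    rw [hνint n Q Q.continuous, hνint n f f.continuous, ← mul_sub, ← Finset.sum_sub_distrib]
    simp_rw [hstep]
    rw [Finset.sum_range_sub fun k => ∫ a, f a ∂μ k]
  have hbound : ∀ n, |∫ a, f a ∂μ n| ≤ ‖f‖ := fun n => by
    have := norm_integral_le_of_norm_le_const (μ := μ n) (ae_of_all _ fun a => f.norm_coe_le_norm a)
    simpa using this
  have hzero : Tendsto (fun n => ∫ a, Q a ∂ν n - ∫ a, f a ∂ν n) atTop (𝓝 0) := by
    have hinv : Tendsto (fun n : ℕ => ((n + 1 : ℕ) : ℝ)⁻¹ * (‖f‖ + ‖f‖)) atTop (𝓝 0) := by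
      have := (tendsto_inv_atTop_nhds_zero_nat (𝕜 := ℝ)).comp (tendsto_add_atTop_nat 1)
      simpa using this.mul_const (‖f‖ + ‖f‖)
    refine squeeze_zero_norm (fun n => ?_) hinv
    rw [hdiff, norm_mul, Real.norm_of_nonneg (by positivity)]
    gcongr
    exact (abs_sub _ _).trans (add_le_add (hbound _) (hbound _))
  have hU : (hyperfilter ℕ : Filter ℕ) ≤ atTop := Nat.hyperfilter_le_atTop
  exact sub_eq_zero.1 (tendsto_nhds_unique (hQ.sub hf) (hzero.mono_left hU))

end General

/-! ### Left Haar measure of a compact hypergroup. -/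

namespace HypergroupStructure

variable {D : Type*} [TopologicalSpace D] [LocallyCompactSpace D]
    [T2Space D] [SecondCountableTopology D] [MeasurableSpace D] [BorelSpace D] [CompactSpace D]
    (H : HypergroupStructure D)

/-- The convolution of point masses as a Markov kernel. -/
noncomputable def convKernel : Kernel (D × D) D where
  toFun p := H.conv p.1 p.2
  measurable' := measurable_of_continuous_integral H.continuous_conv

theorem convKernel_apply (p : D × D) : H.convKernel p = H.conv p.1 p.2 := rfl

instance : IsMarkovKernel H.convKernel :=
  ⟨fun p => inferInstanceAs (IsProbabilityMeasure (H.conv p.1 p.2 : Measure D))⟩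

theorem continuous_integral_conv (f : C(D, ℝ)) :
    Continuous fun p : D × D => ∫ z, f z ∂(H.conv p.1 p.2 : Measure D) :=
  (ProbabilityMeasure.continuous_integral_continuousMap f).comp H.continuous_conv

theorem integral_conv_assoc (f : C(D, ℝ)) (x y z : D) :
    ∫ w, ∫ v, f v ∂(H.conv w z : Measure D) ∂(H.conv x y : Measure D) =
      ∫ w, ∫ v, f v ∂(H.conv x w : Measure D) ∂(H.conv y z : Measure D) := by
  have h : H.convKernel.sectL z ∘ₘ (H.conv x y : Measure D) =
      H.convKernel.sectR x ∘ₘ (H.conv y z : Measure D) := by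
    ext A hA
    rw [Measure.bind_apply hA (Kernel.aemeasurable _), Measure.bind_apply hA (Kernel.aemeasurable _)]
    exact H.conv_assoc x y z A hA
  have h1 := Measure.integral_comp_kernel (μ := (H.conv x y : Measure D))
    (κ := H.convKernel.sectL z) (f := f) f.continuous.integrable_of_compactSpace
  have h2 := Measure.integral_comp_kernel (μ := (H.conv y z : Measure D))
    (κ := H.convKernel.sectR x) (f := f) f.continuous.integrable_of_compactSpace
  rw [h, h2] at h1
  exact h1.symm

/-- If a continuous function has the mean value property for all right convolutions by `μ` and
`μ` has full support, then the function does not exceed its value at the neutral element. -/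
theorem le_apply_e_of_integral_conv {μ : Measure D} [IsProbabilityMeasure μ] [μ.IsOpenPosMeasure]
    {h : C(D, ℝ)} (hh : ∀ x, ∫ y, ∫ z, h z ∂(H.conv x y : Measure D) ∂μ = h x) (x : D) :
    h x ≤ h H.e := by
  obtain ⟨x₀, -, hx₀⟩ := isCompact_univ.exists_isMaxOn ⟨x, Set.mem_univ x⟩ h.continuous.continuousOn
  have hmax : ∀ z, h z ≤ h x₀ := fun z => hx₀ (Set.mem_univ z)
  have hle : ∀ y, ∫ z, h z ∂(H.conv x₀ y : Measure D) ≤ h x₀ := fun y => by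
    have := integral_mono (μ := (H.conv x₀ y : Measure D)) h.continuous.integrable_of_compactSpace
      (integrable_const (h x₀)) hmax
    simpa using this
  -- The maximum principle is used twice: over `μ`, to reach `y = bar x₀`, then over `δ_{x₀} *
  -- δ_{bar x₀}`, whose support contains `e`.
  have hmean : ∫ z, h z ∂(H.conv x₀ (H.bar x₀) : Measure D) = h x₀ :=
    eq_of_mem_support_of_integral_eq (μ := μ)
      ((H.continuous_integral_conv h).comp (Continuous.prodMk_right x₀)) hle (hh x₀)
      (by rw [Measure.support_eq_univ]; trivial)
  rw [eq_of_mem_support_of_integral_eq h.continuous hmax hmean ((H.e_mem_support_iff _ _).2 rfl)]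
  exact hmax x

/-- A compact hypergroup has a left invariant probability measure. -/
theorem exists_integral_conv_eq :
    ∃ m : ProbabilityMeasure D, ∀ (f : C(D, ℝ)) (x : D),
      ∫ y, ∫ z, f z ∂(H.conv x y : Measure D) ∂(m : Measure D) = ∫ y, f y ∂(m : Measure D) := by
  have : Nonempty D := ⟨H.e⟩
  obtain ⟨μ, hμ, hμ'⟩ := exists_isProbabilityMeasure_isOpenPosMeasure D
  -- The random walk `x ↦ μ * δ_x`; a stationary `m` satisfies `μ * m = m`.
  let κ : Kernel D D := H.convKernel ∘ₖ (Kernel.const D μ ×ₖ Kernel.id)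
  have hκ : ∀ (f : C(D, ℝ)) (x : D),
      ∫ z, f z ∂κ x = ∫ y, ∫ z, f z ∂(H.conv y x : Measure D) ∂μ := by
    intro f x
    have hp : Integrable (fun p : D × D => ∫ z, f z ∂(H.conv p.1 p.2 : Measure D))
        (μ.prod (Measure.dirac x)) := (H.continuous_integral_conv f).integrable_of_compactSpace
    have hc := Kernel.integral_comp (η := H.convKernel) (κ := Kernel.const D μ ×ₖ Kernel.id)
      (a := x) (f := f) f.continuous.integrable_of_compactSpace
    rw [Kernel.prod_apply, Kernel.const_apply, Kernel.id_apply] at hc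
    refine hc.trans ((integral_prod _ hp).trans ?_)
    simp only [integral_dirac]
  obtain ⟨m, hm⟩ := exists_invariant_probabilityMeasure κ (fun f => by
    simp_rw [hκ]
    exact continuous_integral_of_compactSpace
      (f := fun x y => ∫ z, f z ∂(H.conv y x : Measure D))
      ((H.continuous_integral_conv f).comp continuous_swap))
  simp_rw [hκ] at hm
  refine ⟨m, fun f x => ?_⟩
  have key : ∀ f : C(D, ℝ), ∃ h : C(D, ℝ),
      (∀ x, h x = ∫ y, ∫ z, f z ∂(H.conv x y : Measure D) ∂(m : Measure D)) ∧
      ∀ x, ∫ y, ∫ z, h z ∂(H.conv x y : Measure D) ∂μ = h x := by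
    intro f
    refine ⟨⟨fun x => ∫ y, ∫ z, f z ∂(H.conv x y : Measure D) ∂(m : Measure D),
      continuous_integral_of_compactSpace
        (f := fun x y => ∫ z, f z ∂(H.conv x y : Measure D)) (H.continuous_integral_conv f)⟩,
      fun x => rfl, fun x => ?_⟩
    -- Associativity rewrites `f((x * y) * z)` as `g(y * z)`, to which stationarity of `m` applies.
    let g : C(D, ℝ) := ⟨fun w => ∫ v, f v ∂(H.conv x w : Measure D),
      (H.continuous_integral_conv f).comp (Continuous.prodMk_right x)⟩
    calc
      _ = ∫ y, ∫ z, ∫ w, g w ∂(H.conv y z : Measure D) ∂(m : Measure D) ∂μ := by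
        refine integral_congr_ae (ae_of_all _ fun y => ?_)
        refine (integral_integral_swap_of_hasCompactSupport
          (f := fun w z => ∫ v, f v ∂(H.conv w z : Measure D))
          (H.continuous_integral_conv f) (HasCompactSupport.of_compactSpace _)).trans ?_
        exact integral_congr_ae (ae_of_all _ fun z => H.integral_conv_assoc f x y z)
      _ = ∫ z, ∫ y, ∫ w, g w ∂(H.conv y z : Measure D) ∂μ ∂(m : Measure D) :=
        integral_integral_swap_of_hasCompactSupport
          (f := fun y z => ∫ v, g v ∂(H.conv y z : Measure D))
          (H.continuous_integral_conv g) (HasCompactSupport.of_compactSpace _)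
      _ = ∫ z, g z ∂(m : Measure D) := hm g
  have hle : ∀ f : C(D, ℝ), ∫ y, ∫ z, f z ∂(H.conv x y : Measure D) ∂(m : Measure D) ≤
      ∫ y, f y ∂(m : Measure D) := by
    intro f
    obtain ⟨h, hh, hh'⟩ := key f
    have := H.le_apply_e_of_integral_conv hh' x
    rw [hh, hh] at this
    simpa only [H.e_conv, integral_dirac] using this
  refine le_antisymm (hle f) ?_
  -- The bound is linear in `f`, so the sign change gives the reverse inequality.
  have := hle (-f)
  simp only [ContinuousMap.coe_neg, Pi.neg_apply, integral_neg] at this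
  exact neg_le_neg_iff.1 this

/-- A compact hypergroup has a left Haar measure. -/
theorem exists_isLeftHaar : ∃ ω : Measure D, H.IsLeftHaar ω := by
  obtain ⟨m, hm⟩ := H.exists_integral_conv_eq
  refine ⟨m, inferInstance, IsProbabilityMeasure.ne_zero _, fun f x => ?_⟩
  have h : H.convKernel.sectR x ∘ₘ (m : Measure D) = m := by
    refine ext_of_forall_integral_eq_of_IsFiniteMeasure fun g => ?_
    rw [Measure.integral_comp_kernel g.continuous.integrable_of_compactSpace]
    exact hm g.toContinuousMap x
  have hf : Integrable f (H.convKernel.sectR x ∘ₘ (m : Measure D)) :=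
    f.continuous.integrable_of_compactSpace
  have := Measure.integral_comp_kernel hf
  rw [h] at this
  exact this.symm

variable {H}

theorem IsLeftHaar.isFiniteMeasure {ω : Measure D} (hω : H.IsLeftHaar ω) : IsFiniteMeasure ω :=
  have := hω.regular
  inferInstance

theorem IsLeftHaar.integral_conv {ω : Measure D} (hω : H.IsLeftHaar ω) (f : C(D, ℝ)) (x : D) :
    ∫ y, ∫ z, f z ∂(H.conv x y : Measure D) ∂ω = ∫ y, f y ∂ω := by
  have := hω.invariant ⟨⟨fun z => (f z : ℂ), by fun_prop⟩, HasCompactSupport.of_compactSpace _⟩ x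
  change ∫ y, (∫ z, (f z : ℂ) ∂(H.conv x y : Measure D)) ∂ω = ∫ y, (f y : ℂ) ∂ω at this
  simp_rw [integral_complex_ofReal] at this
  exact_mod_cast this

theorem IsLeftHaar.smul {ω : Measure D} (hω : H.IsLeftHaar ω) {c : ℝ≥0} (hc : 0 < c) :
    H.IsLeftHaar (c • ω) where
  regular := haveI := hω.isFiniteMeasure; inferInstance
  ne_zero := fun h => hω.ne_zero ((smul_eq_zero.1 h).resolve_left hc.ne')
  invariant f x := by
    rw [integral_smul_nnreal_measure, integral_smul_nnreal_measure, hω.invariant f x]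

end HypergroupStructure

/-! ### Averaging the transition operators of a compact scheme. -/

namespace ContinuousAssociationScheme

variable {X D : Type*}
    [TopologicalSpace X] [LocallyCompactSpace X] [T2Space X] [SecondCountableTopology X]
    [MeasurableSpace X] [BorelSpace X]
    [TopologicalSpace D] [LocallyCompactSpace D] [T2Space D] [SecondCountableTopology D]
    [MeasurableSpace D] [BorelSpace D]
    [CompactSpace X] (S : ContinuousAssociationScheme X D)

instance : IsMarkovKernel S.K := S.isMarkov

theorem continuous_integral_kernel (f : C(X, ℝ)) :
    Continuous fun p : X × D => ∫ y, f y ∂(S.K p) := by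
  have h := S.continuous_kernel
    (BoundedContinuousFunction.mkOfCompact ⟨fun y => (f y : ℂ), by fun_prop⟩)
  have h' := Complex.continuous_re.comp h
  refine h'.congr fun p => ?_
  change (∫ y, (f y : ℂ) ∂(S.K p)).re = _
  rw [integral_complex_ofReal, Complex.ofReal_re]

theorem integral_kernel_kernel (f : C(X, ℝ)) (h₁ h₂ : D) (x : X) :
    ∫ y, ∫ z, f z ∂(S.K (y, h₂)) ∂(S.K (x, h₁)) =
      ∫ h, ∫ z, f z ∂(S.K (x, h)) ∂(S.hypergroup.conv h₁ h₂ : Measure D) := by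
  have h : S.K.sectL h₂ ∘ₘ S.K (x, h₁) =
      S.K.sectR x ∘ₘ (S.hypergroup.conv h₁ h₂ : Measure D) := by
    ext A hA
    rw [Measure.bind_apply hA (Kernel.aemeasurable _), Measure.bind_apply hA (Kernel.aemeasurable _)]
    exact S.comp_eq h₁ h₂ x A hA
  have e₁ := Measure.integral_comp_kernel (μ := S.K (x, h₁)) (κ := S.K.sectL h₂) (f := f)
    f.continuous.integrable_of_compactSpace
  have e₂ := Measure.integral_comp_kernel (μ := (S.hypergroup.conv h₁ h₂ : Measure D))
    (κ := S.K.sectR x) (f := f) f.continuous.integrable_of_compactSpace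
  rw [h, e₂] at e₁
  exact e₁.symm

/-- A continuous function fixed by all transition operators is constant. -/
theorem eq_of_forall_integral_kernel_eq {F : C(X, ℝ)}
    (hF : ∀ (x : X) (h : D), ∫ y, F y ∂(S.K (x, h)) = F x) (x y : X) : F x = F y := by
  obtain ⟨x₀, -, hx₀⟩ := isCompact_univ.exists_isMaxOn ⟨x, Set.mem_univ x⟩ F.continuous.continuousOn
  have hmax : ∀ z, F z = F x₀ := fun z =>
    eq_of_mem_support_of_integral_eq F.continuous (fun w => hx₀ (Set.mem_univ w))
      (hF x₀ (S.proj (x₀, z))) ((S.mem_support_iff x₀ z _).2 rfl)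
  rw [hmax x, hmax y]

variable {S} {ωD : Measure D} {ωX : Measure X}

theorem isFiniteMeasure_of_isAdjointMeasure (hX : IsAdjointMeasure S.K S.hypergroup.bar ωX) :
    IsFiniteMeasure ωX :=
  have := hX.regular
  inferInstance

/-- An invariant measure is stationary for all transition operators. -/
theorem integral_integral_kernel_of_isAdjointMeasure
    (hX : IsAdjointMeasure S.K S.hypergroup.bar ωX) (f : C(X, ℝ)) (h : D) :
    ∫ x, ∫ y, f y ∂(S.K (x, h)) ∂ωX = ∫ x, f x ∂ωX := by
  -- Compactness of `X` allows the test function `1`, which the Markov operators fix.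
  have := hX.adjoint (S.hypergroup.bar h)
    ⟨⟨fun z => (f z : ℂ), by fun_prop⟩, HasCompactSupport.of_compactSpace _⟩
    ⟨⟨fun _ => 1, continuous_const⟩, HasCompactSupport.of_compactSpace _⟩
  rw [S.hypergroup.bar_bar] at this
  change ∫ x, (∫ y, (f y : ℂ) ∂(S.K (x, h))) * 1 ∂ωX =
    ∫ x, (f x : ℂ) * ∫ y, (1 : ℂ) ∂(S.K (x, S.hypergroup.bar h)) ∂ωX at this
  simp only [integral_complex_ofReal, integral_const, probReal_univ, one_smul, mul_one] at this
  exact_mod_cast this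

/-- On the support of `K_k(x, ·)`, a set of full measure, `f ∘ π(x, ·)` is the constant `f k` and
leaves the inner integral. -/
theorem translationIdentity_of_eq_comp [IsFiniteMeasure ωD]
    (h : ∀ x : X, ωX = S.K.sectR x ∘ₘ ωD) : S.TranslationIdentity ωD ωX := by
  intro f g x
  have hfg : Continuous fun y => f (S.proj (x, y)) * g y :=
    (f.continuous.comp (S.continuous_proj.comp (Continuous.prodMk_right x))).mul g.continuous
  rw [h x, Measure.integral_comp_kernel hfg.integrable_of_compactSpace]
  refine integral_congr_ae (ae_of_all _ fun k => ?_)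
  change (∫ y, g y ∂(S.K (x, k))) * f k = ∫ y, f (S.proj (x, y)) * g y ∂(S.K (x, k))
  rw [mul_comm, ← integral_const_mul]
  refine integral_congr_ae ?_
  filter_upwards [Measure.support_mem_ae (μ := S.K (x, k))] with y hy
  rw [(S.mem_support_iff x y k).1 hy]

variable [CompactSpace D]

/-- The mean of the transition operators over the hypergroup maps every continuous function to a
constant. -/
theorem integral_integral_kernel_eq (hD : S.hypergroup.IsLeftHaar ωD) (f : C(X, ℝ)) (x y : X) :
    ∫ h, ∫ z, f z ∂(S.K (x, h)) ∂ωD = ∫ h, ∫ z, f z ∂(S.K (y, h)) ∂ωD := by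
  have := hD.isFiniteMeasure
  let F : C(X, ℝ) := ⟨fun x => ∫ h, ∫ z, f z ∂(S.K (x, h)) ∂ωD,
    continuous_integral_of_compactSpace (f := fun x h => ∫ z, f z ∂(S.K (x, h)))
      (S.continuous_integral_kernel f)⟩
  refine S.eq_of_forall_integral_kernel_eq (F := F) (fun x h₁ => ?_) x y
  let g : C(D, ℝ) := ⟨fun h => ∫ z, f z ∂(S.K (x, h)),
    (S.continuous_integral_kernel f).comp (Continuous.prodMk_right x)⟩
  calc
    _ = ∫ h, ∫ y, ∫ z, f z ∂(S.K (y, h)) ∂(S.K (x, h₁)) ∂ωD :=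
      integral_integral_swap_of_hasCompactSupport (f := fun y h => ∫ z, f z ∂(S.K (y, h)))
        (S.continuous_integral_kernel f) (HasCompactSupport.of_compactSpace _)
    _ = ∫ h, ∫ k, g k ∂(S.hypergroup.conv h₁ h : Measure D) ∂ωD :=
      integral_congr_ae (ae_of_all _ fun h => S.integral_kernel_kernel f h₁ h x)
    _ = ∫ h, g h ∂ωD := hD.integral_conv g h₁

/-- Both sides are the double integral of `T_h f(y)` over `ωX` and `ωD`: one order uses constancy of
the Haar mean, the other stationarity of `ωX`. -/
theorem measureReal_mul_integral_eq (hD : S.hypergroup.IsLeftHaar ωD)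
    (hX : IsAdjointMeasure S.K S.hypergroup.bar ωX) (f : C(X, ℝ)) (x : X) :
    ωX.real Set.univ * ∫ h, ∫ y, f y ∂(S.K (x, h)) ∂ωD =
      ωD.real Set.univ * ∫ y, f y ∂ωX := by
  have := hD.isFiniteMeasure
  have := isFiniteMeasure_of_isAdjointMeasure hX
  calc
    _ = ∫ y, ∫ h, ∫ z, f z ∂(S.K (y, h)) ∂ωD ∂ωX := by
      simp_rw [fun y => integral_integral_kernel_eq hD f y x]
      simp
    _ = ∫ h, ∫ y, ∫ z, f z ∂(S.K (y, h)) ∂ωX ∂ωD :=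
      integral_integral_swap_of_hasCompactSupport (f := fun y h => ∫ z, f z ∂(S.K (y, h)))
        (S.continuous_integral_kernel f) (HasCompactSupport.of_compactSpace _)
    _ = _ := by
      simp_rw [integral_integral_kernel_of_isAdjointMeasure hX f]
      simp

/-- Every invariant measure is, up to normalization, the mean over the hypergroup of the measures
`K_h(x, ·)`. -/
theorem exists_eq_comp_smul (hD : S.hypergroup.IsLeftHaar ωD)
    (hX : IsAdjointMeasure S.K S.hypergroup.bar ωX) :
    ∃ c : ℝ≥0, 0 < c ∧ ∀ x : X, ωX = S.K.sectR x ∘ₘ (c • ωD) := by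
  rcases isEmpty_or_nonempty X with hX₀ | ⟨⟨x₀⟩⟩
  · exact ⟨1, one_pos, fun x => (hX₀.false x).elim⟩
  have := hD.isFiniteMeasure
  have := isFiniteMeasure_of_isAdjointMeasure hX
  have hD0 : 0 < ωD.real Set.univ := by
    have := hD.ne_zero
    rw [measureReal_def]
    exact ENNReal.toReal_pos (Measure.measure_univ_ne_zero.2 this) (measure_ne_top _ _)
  have hX0 : 0 < ωX.real Set.univ := by
    have : ωX ≠ 0 := fun h => by
      have := hX.support_eq
      rw [h, Measure.support_zero] at this
      exact (this ▸ Set.mem_univ x₀ : x₀ ∈ (∅ : Set X))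
    rw [measureReal_def]
    exact ENNReal.toReal_pos (Measure.measure_univ_ne_zero.2 this) (measure_ne_top _ _)
  -- The kernels preserve mass, so `c` must be the ratio of total masses.
  obtain ⟨c, hc⟩ : ∃ c : ℝ≥0, (c : ℝ) = ωX.real Set.univ / ωD.real Set.univ :=
    ⟨⟨_, (div_pos hX0 hD0).le⟩, rfl⟩
  refine ⟨c, NNReal.coe_pos.1 (hc ▸ div_pos hX0 hD0), fun x => ?_⟩
  refine ext_of_forall_integral_eq_of_IsFiniteMeasure fun f => ?_
  rw [Measure.integral_comp_kernel f.continuous.integrable_of_compactSpace,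
    integral_smul_nnreal_measure, NNReal.smul_def, hc, smul_eq_mul]
  rw [div_mul_eq_mul_div, eq_div_iff hD0.ne', mul_comm]
  exact (measureReal_mul_integral_eq hD hX f.toContinuousMap x).symm

end ContinuousAssociationScheme

theorem proposition5p5 {X D : Type*}
    [TopologicalSpace X] [LocallyCompactSpace X] [T2Space X] [SecondCountableTopology X]
    [MeasurableSpace X] [BorelSpace X]
    [TopologicalSpace D] [LocallyCompactSpace D] [T2Space D] [SecondCountableTopology D]
    [MeasurableSpace D] [BorelSpace D]
    [CompactSpace X] [CompactSpace D]
    (S : ContinuousAssociationScheme X D) :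
    -- property (T2)
    S.HasT2 ∧
    -- for any choice of the invariant measure and of the left Haar measure, after normalization,
    -- `ω_X = ∫_D K_h(x, ·) dω_D(h)` for every `x`, and `T_f = T^{f ∘ π}` for all `f ∈ C_c(D)`
    (∀ (ωD : Measure D) (ωX : Measure X), S.hypergroup.IsLeftHaar ωD →
      IsAdjointMeasure S.K S.hypergroup.bar ωX →
      ∃ c : ℝ≥0, 0 < c ∧
        (∀ (x : X) (A : Set X), MeasurableSet A →
          ωX A = ∫⁻ h, S.K (x, h) A ∂(c • ωD)) ∧
        S.TranslationIdentity (c • ωD) ωX) ∧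
    -- uniqueness of the invariant measure up to a positive constant
    (∀ ωX ωX' : Measure X, IsAdjointMeasure S.K S.hypergroup.bar ωX →
      IsAdjointMeasure S.K S.hypergroup.bar ωX' →
      ∃ c : ℝ≥0, 0 < c ∧ ωX' = c • ωX) := by
  obtain ⟨ωD, hD⟩ := S.hypergroup.exists_isLeftHaar
  refine ⟨?_, fun ωD ωX hD hX => ?_, fun ωX ωX' hX hX' => ?_⟩
  · obtain ⟨ωX, hX⟩ := S.exists_adjointMeasure
    obtain ⟨c, hc, h⟩ := ContinuousAssociationScheme.exists_eq_comp_smul hD hX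
    have := (hD.smul hc).isFiniteMeasure
    exact ⟨c • ωD, ωX, hD.smul hc, hX,
      ContinuousAssociationScheme.translationIdentity_of_eq_comp h⟩
  · obtain ⟨c, hc, h⟩ := ContinuousAssociationScheme.exists_eq_comp_smul hD hX
    have := (hD.smul hc).isFiniteMeasure
    refine ⟨c, hc, fun x A hA => ?_, ContinuousAssociationScheme.translationIdentity_of_eq_comp h⟩
    conv_lhs => rw [h x]
    exact Measure.bind_apply hA (Kernel.aemeasurable _)
  · rcases isEmpty_or_nonempty X with hX₀ | ⟨⟨x⟩⟩
    · exact ⟨1, one_pos, Subsingleton.elim _ _⟩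
    obtain ⟨c, hc, h⟩ := ContinuousAssociationScheme.exists_eq_comp_smul hD hX
    obtain ⟨c', hc', h'⟩ := ContinuousAssociationScheme.exists_eq_comp_smul hD hX'
    -- Both measures are multiples of the same mean of `K_h(x, ·)` over one fixed `ωD`.
    refine ⟨c' / c, div_pos hc' hc, ?_⟩
    rw [h x, h' x, Measure.bind_smul, Measure.bind_smul, smul_smul, div_mul_cancel₀ _ hc.ne']
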